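/- **Setting.** *Oracle machines.* An oracle is a total function $O:\{0,1\}^*\to\{0,1\}$. Machines are multi-tape oracle Turing machines; nondeterministic steps choose between two instructions, and a query asks the oracle about the word written on the oracle tape (unit cost). "Polynomial time" means that, for some polynomial $p$, all computations halt within $p(n)$ steps, for every input of total length $n$ and every oracle. A *computation path* is the list $\tau\in\{0,1\}^*$ of nondeterministic choice bits and oracle answers in chronological order; $\#\mathrm{acc}_{T^O}(x)$ is the number of accepting computation paths of $T$ on input $x$ with oracle $O$. A function $F$ of pairs $(x,O)$, given with a set $D$ of "don't care" inputs, is in $\mathsf{Pr}\text{-}\#\mathsf{P}$ (with oracle) if there are a relation $R(x,y,O)$ decided by a deterministic polynomial-time oracle machine and a polynomial $p$ such that $F(x,O)=\#\{y\in\{0,1\}^*: |y|\le p(|x|),\ R(x,y,O)\}$ for all $(x,O)\notin D$. *Categories.* Let $C$ be a locally small category, $P\subseteq C$ a full subcategory closed under isomorphism, and $\mathcal E,\mathcal M$ classes of morphisms of $C$. $(\mathcal E,\mathcal M)$ is a *proper factorization system* if both classes contain all isomorphisms and are closed under composition, every morphism factors as $me$ with $e\in\mathcal E$, $m\in\mathcal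 M$, uniquely up to a unique isomorphism, all morphisms in $\mathcal E$ are epi and all morphisms in $\mathcal M$ are mono. An $\mathcal M$-*subobject* of $b$ is a morphism $f\in\mathcal M$ with codomain $b$, up to isomorphism over $b$. They form a poset $\mathrm{Sub}_{\mathcal M}(b)$, where $f'\preceq f$ iff $f'=fg$ for some $g$. $\binom{b}{a}$ denotes the set of those $\mathcal M$-subobjects of $b$ that have domain isomorphic to $a$, and $\#\binom{b}{a}$ is their number. $C$ is *finitely $\mathcal M$-well-powered* if all $\mathrm{Sub}_{\mathcal M}(b)$ are finite; it has *joint $\mathcal M$-embedding* if for all $a,b$ there are $c$ and morphisms $a\to c$, $b\to c$ in $\mathcal M$; it is *$\mathcal M$-Ramsey* if for all $a,b\in C$ and $t\in\mathbb N$ there is $c\in C$ such that for every $\Phi:\binom{c}{a}\to\{0,\dots,t\}$ there is $f\in\binom{c}{b}$ with $\Phi$ constant on $\{g\in\binom{c}{a}: g\preceq f\}$. The *blowup property* holds if for all $c\in C$ and $k\in\mathbb N$ there is $c'\in C$ with $\#\binom{c'}{a}>k$ for every $a\notin P$ that has a morphism $a\to c$ in $\mathcal M$, and $\#\binom{c'}{a}=\#\binom{c}{a}$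 for every $a\in P$. *Motif parameters.* A motif parameter is a function $\varphi(c)=\sum_{i=1}^s\alpha_i\,\#\binom{c}{a_i}$ on the objects of $C$, with pairwise non-isomorphic patterns $a_i\in C$ and coefficients $\alpha_i\in\mathbb Q$. It is *$P$-pure* if all $a_i$ with $\alpha_i\ne0$ are in $P$, and *good* if moreover all $\alpha_i$ are nonnegative integers. *Oracle encoding.* For every $j\in\mathbb N$ a set $C_j$ of objects of $C$ is fixed whose elements are encoded injectively as subsets of $\{0,1\}^{\mathrm{bitsize}(j)}$, where $\mathrm{bitsize}(j)$ is computable in polynomial time and bounded by a polynomial in the binary length of $j$; every object of $C$ is isomorphic to an element of some $C_j$. An object $c\in C_j$ is given to a machine as the input $j$ in binary, together with the indicator function of its encoding as oracle. $\mathrm{eval}_\varphi$ is the function that maps the input given by $c\in C_j$ to $\varphi(c)$; all inputs that do not encode an object are "don't care" inputs. A nondeterministic machine $T$ *computes* $\mathrm{eval}_\varphi$ if $\#\mathrm{acc}_{T^c}(j)=\varphi(c)$ for all $j$ and $c\in C_j$. *Set-instantiators.* A set-instantiator against $(T,c,\varphi)$ consists of some $j\in\mathbb N$, a function $\mathrm{inst}:\mathrm{Sub}_{\mathcal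 M}(c)\to C_j$ and a function $\mathrm{perc}:\{0,1\}^*\to\mathrm{Sub}_{\mathcal M}(c)\cup\{\top\}$, where $\top$ is a new top element, such that for all $f\in\mathrm{Sub}_{\mathcal M}(c)$: a string $\tau$ is an accepting computation path of $T^{\mathrm{inst}(f)}(j)$ iff $\mathrm{perc}(\tau)\preceq f$; and $\varphi(\mathrm{inst}(f))=\varphi(\mathrm{dom} f)$. **Theorem.** Suppose that $(\mathcal E,\mathcal M)$ is a proper factorization system of $C$ whose restriction to $P$ is a proper factorization system of $P$, that $C$ and $P$ are both finitely $\mathcal M$-well-powered and both have joint $\mathcal M$-embedding, that $C$ is $\mathcal M$-Ramsey, and that $C$ and $P$ fulfill the blowup property. Let $\varphi$ be a $P$-pure motif parameter. If for every nondeterministic polynomial-time oracle Turing machine $T$ computing $\mathrm{eval}_\varphi$ and every object $c\in C$ there is a set-instantiator against $(T,c,\varphi)$, then $\mathrm{eval}_\varphi\notin\mathsf{Pr}\text{-}\#\mathsf{P}$ (with oracle), unless $\varphi$ is good, that is, unless all its coefficients are nonnegative integers. -/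

import Mathlib

open CategoryTheory

universe u v

noncomputable section

/-! ## Oracle Turing machines, polynomial time, and promise type-2 counting -/

/-- An oracle is a total function `{0,1}* → {0,1}`. -/
abbrev Oracle : Type := List Bool → Bool

/-- Tape symbols: the blank `none`, the bits `some (inl b)`, and further work symbols. -/
abbrev TapeSym (A : Type) : Type := Option (Bool ⊕ A)

/-- What a machine does in one step: the next state, the symbol written and the head move
(`none` is "stay") on each tape, and possibly one bit that is appended to the oracle tape. -/
structure Instr (Q K A : Type) where
  next : Q
  write : K → TapeSym A
  move : K → Option Turing.Dir
  out : Option Bool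

/-- The command that a machine executes in a given situation. A nondeterministic choice is between
two instructions; a query asks the oracle about the word on the oracle tape, erases that tape, and
continues according to the answer. -/
inductive Cmd (Q K A : Type) where
  | halt (accept : Bool)
  | step (i : Instr Q K A)
  | choose (i : Bool → Instr Q K A)
  | query (i : Bool → Instr Q K A)

/-- A nondeterministic multi-tape oracle Turing machine which gets `r` input strings, each on
a tape of its own (`inp`). All other tapes, and the oracle tape, are empty at the start. -/
structure OracleTM (r : ℕ) where
  /-- tapes -/
  K : Type
  /-- additional tape symbols -/
  A : Type
  /-- states -/
  Q : Type
  finK : Finite K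
  finA : Finite A
  finQ : Finite Q
  inp : Fin r ↪ K
  start : Q
  /-- the program: a function of the state and of the symbols under the heads -/
  δ : Q → (K → TapeSym A) → Cmd Q K A

namespace OracleTM

variable {r : ℕ} (T : OracleTM r)

/-- Configurations: the state, the tapes, and the word on the oracle tape. -/
structure Cfg where
  state : T.Q
  tape : T.K → Turing.Tape (TapeSym T.A)
  oracleTape : List Bool

variable {T}

/-- The command to be executed in a configuration. -/
def Cfg.cmd (c : T.Cfg) : Cmd T.Q T.K T.A :=
  T.δ c.state (fun k => (c.tape k).head)

/-- Moving the head of a tape, where `none` is "stay". -/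
def moveHead {Γ : Type} [Inhabited Γ] : Option Turing.Dir → Turing.Tape Γ → Turing.Tape Γ
  | none, t => t
  | some d, t => t.move d

/-- Executing an instruction. -/
def Cfg.exec (c : T.Cfg) (i : Instr T.Q T.K T.A) : T.Cfg where
  state := i.next
  tape := fun k => moveHead (i.move k) ((c.tape k).write (i.write k))
  oracleTape := c.oracleTape ++ i.out.toList

/-- Erasing the oracle tape. -/
def Cfg.erase (c : T.Cfg) : T.Cfg := { c with oracleTape := [] }

/-- `AcceptPath O c τ`: the list `τ` of nondeterministic choice bits and oracle answers, in
chronological order, is the computation path of an accepting computation with oracle `O` that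
starts in `c`. -/
inductive AcceptPath (O : Oracle) : T.Cfg → List Bool → Prop
  | halt {c : T.Cfg} (h : c.cmd = Cmd.halt true) : AcceptPath O c []
  | step {c : T.Cfg} {i : Instr T.Q T.K T.A} {τ : List Bool} (h : c.cmd = Cmd.step i)
      (hτ : AcceptPath O (c.exec i) τ) : AcceptPath O c τ
  | choose {c : T.Cfg} {i : Bool → Instr T.Q T.K T.A} {τ : List Bool} (h : c.cmd = Cmd.choose i)
      (b : Bool) (hτ : AcceptPath O (c.exec (i b)) τ) : AcceptPath O c (b :: τ)
  | query {c : T.Cfg} {i : Bool → Instr T.Q T.K T.A} {τ : List Bool} (h : c.cmd = Cmd.query i)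
      (hτ : AcceptPath O (c.erase.exec (i (O c.oracleTape))) τ) :
      AcceptPath O c (O c.oracleTape :: τ)

/-- With oracle `O`, all computations that start in `c` halt after at most `n` steps. -/
def HaltsWithin (O : Oracle) : ℕ → T.Cfg → Prop
  | 0, c => ∃ a, c.cmd = Cmd.halt a
  | n + 1, c =>
    match c.cmd with
    | Cmd.halt _ => True
    | Cmd.step i => HaltsWithin O n (c.exec i)
    | Cmd.choose i => ∀ b, HaltsWithin O n (c.exec (i b))
    | Cmd.query i => HaltsWithin O n (c.erase.exec (i (O c.oracleTape)))

variable (T)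

/-- The initial configuration on input strings `x`. -/
def init (x : Fin r → List Bool) : T.Cfg where
  state := T.start
  tape := Function.extend T.inp
    (fun i => Turing.Tape.mk₁ ((x i).map (fun b => some (Sum.inl b))))
    (fun _ => Turing.Tape.mk₁ [])
  oracleTape := []

/-- `τ` is an accepting computation path on input `x` with oracle `O`. -/
def IsAcceptingPath (x : Fin r → List Bool) (O : Oracle) (τ : List Bool) : Prop :=
  AcceptPath O (T.init x) τ

/-- The number of accepting computation paths on input `x` with oracle `O`. -/
def acc (x : Fin r → List Bool) (O : Oracle) : ℕ :=
  {τ : List Bool | T.IsAcceptingPath x O τ}.ncard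

/-- The machine accepts `x` with oracle `O`. -/
def Accepts (x : Fin r → List Bool) (O : Oracle) : Prop :=
  ∃ τ, T.IsAcceptingPath x O τ

/-- Polynomial running time in the input length, uniformly in the oracle. -/
def PolyTime : Prop :=
  ∃ p : Polynomial ℕ, ∀ (x : Fin r → List Bool) (O : Oracle),
    HaltsWithin O (p.eval (∑ i, (x i).length)) (T.init x)

/-- A deterministic machine never makes a nondeterministic choice. -/
def Deterministic : Prop :=
  ∀ (q : T.Q) (s : T.K → TapeSym T.A) (i : Bool → Instr T.Q T.K T.A), T.δ q s ≠ Cmd.choose i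

end OracleTM

/-- A `k`-ary type-2 relation. -/
abbrev TypeTwoRel (k : ℕ) : Type := (Fin k → List Bool) → Oracle → Prop

/-- `R` is decided by a deterministic polynomial-time oracle Turing machine. -/
def TypeTwoRel.PolyTimeComputable {k : ℕ} (R : TypeTwoRel k) : Prop :=
  ∃ T : OracleTM k, T.Deterministic ∧ T.PolyTime ∧ ∀ x O, T.Accepts x O ↔ R x O

/-- The counting problem `#R (x, O)`, the number of `y` with `R (x, y, O)`, where the length of
`y` is bounded by the polynomial `p` in `|x|`. -/
def TypeTwoRel.count (R : TypeTwoRel 2) (p : Polynomial ℕ) (x : List Bool) (O : Oracle) : ℕ :=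
  {y : List Bool | y.length ≤ p.eval x.length ∧ R ![x, y] O}.ncard

/-- A promise type-2 function: a function of `(x, O)` with a set of "don't care" inputs. (The
values are rational, since a motif parameter has rational values a priori.) -/
structure PromiseFunction where
  val : List Bool → Oracle → ℚ
  dontCare : Set (List Bool × Oracle)

/-- The class `Pr-#P` with oracle: `F` coincides outside of the "don't care" inputs with `#R` for
a polynomial-time computable binary type-2 relation `R`. -/
def PrSharpP (F : PromiseFunction) : Prop :=
  ∃ R : TypeTwoRel 2, R.PolyTimeComputable ∧ ∃ p : Polynomial ℕ,
    ∀ (x : List Bool) (O : Oracle), (x, O) ∉ F.dontCare → (R.count p x O : ℚ) = F.val x O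

/-- A nondeterministic machine computes a promise function: outside of the "don't care" inputs,
the value is the number of accepting paths. -/
def OracleTM.Computes (T : OracleTM 1) (F : PromiseFunction) : Prop :=
  ∀ (x : List Bool) (O : Oracle), (x, O) ∉ F.dontCare → (T.acc ![x] O : ℚ) = F.val x O

/-! ## Factorization systems and `M`-subobjects -/

variable {C : Type u} [Category.{v} C]

/-- A factorization system `(E, M)`: both classes contain the isomorphisms and are closed under
composition, and every morphism has an `(E, M)`-factorization, unique up to unique isomorphism. -/
structure IsFactorizationSystem (E M : MorphismProperty C) : Prop where
  iso_left : MorphismProperty.isomorphisms C ≤ E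
  iso_right : MorphismProperty.isomorphisms C ≤ M
  comp_left : E.IsStableUnderComposition
  comp_right : M.IsStableUnderComposition
  exists_fac : ∀ {a b : C} (f : a ⟶ b), Nonempty (MorphismProperty.MapFactorizationData E M f)
  unique_fac : ∀ {a b : C} (f : a ⟶ b) (h h' : MorphismProperty.MapFactorizationData E M f),
    ∃! g : h'.Z ≅ h.Z, h'.i ≫ g.hom = h.i ∧ g.hom ≫ h.p = h'.p

/-- A factorization system is proper if `E` consists of epis and `M` of monos. -/
structure IsProperFactorizationSystem (E M : MorphismProperty C) : Prop
    extends IsFactorizationSystem E M where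
  epi : E ≤ MorphismProperty.epimorphisms C
  mono : M ≤ MorphismProperty.monomorphisms C

/-- The poset of all `M`-subobjects under `b`: classes of morphisms `a ⟶ b` from `M` up to
isomorphism over `b`, where `f' ≤ f` means that `f'` factors through `f`. -/
abbrev MSub (M : MorphismProperty C) (b : C) : Type (max u v) :=
  {S : Subobject b // M S.arrow}

/-- The domain of an `M`-subobject. -/
abbrev MSub.dom {M : MorphismProperty C} {b : C} (S : MSub M b) : C := (S.1 : C)

/-- The set of `M`-subobjects of `a` under `b`: those that are represented by a morphism `a ⟶ b`
from `M`, that is, those whose domain is isomorphic to `a`. -/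
def MSubOf (M : MorphismProperty C) (a b : C) : Set (MSub M b) :=
  {S | Nonempty (S.dom ≅ a)}

/-- The number of `M`-subobjects of `a` under `b`. -/
def cntMSub (M : MorphismProperty C) (a b : C) : ℕ := (MSubOf M a b).ncard

/-- All objects that are the domain of an `M`-subobject under `b`. -/
def domMSub (M : MorphismProperty C) (b : C) : Set C :=
  {a | ∃ f : a ⟶ b, M f}

/-- `C` is finitely `M`-well-powered. -/
def FinitelyWellPowered (M : MorphismProperty C) : Prop :=
  ∀ b : C, Finite (MSub M b)

/-- The joint `M`-embedding property. -/
def JointEmbedding (M : MorphismProperty C) : Prop :=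
  ∀ a b : C, ∃ (c : C) (f : a ⟶ c) (g : b ⟶ c), M f ∧ M g

/-- `C` is `M`-Ramsey. -/
def IsRamsey (M : MorphismProperty C) : Prop :=
  ∀ (a b : C) (t : ℕ), ∃ c : C, ∀ Φ : MSubOf M a c → Fin (t + 1),
    ∃ f ∈ MSubOf M b c, ∀ g g' : MSubOf M a c, g.1 ≤ f → g'.1 ≤ f → Φ g = Φ g'

/-- The blowup property of `C` and its full subcategory `P`. -/
def Blowup (P : ObjectProperty C) (M : MorphismProperty C) : Prop :=
  ∀ (c : C) (k : ℕ), ∃ c' : C,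
    (∀ a ∈ domMSub M c, ¬ P a → k < cntMSub M a c') ∧
    (∀ a : C, P a → cntMSub M a c' = cntMSub M a c)

/-! ## Motif parameters -/

variable (C) in
/-- A (formal) motif parameter: finitely many pairwise non-isomorphic patterns with rational
coefficients. -/
structure MotifParameter where
  s : ℕ
  pattern : Fin s → C
  coeff : Fin s → ℚ
  noniso : ∀ i i', Nonempty (pattern i ≅ pattern i') → i = i'

namespace MotifParameter

/-- The function on objects given by a motif parameter. -/
def val (φ : MotifParameter C) (M : MorphismProperty C) (c : C) : ℚ :=
  ∑ i, φ.coeff i * (cntMSub M (φ.pattern i) c : ℚ)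

/-- All patterns (with non-zero coefficient) are in `P`. -/
def IsPure (φ : MotifParameter C) (P : ObjectProperty C) : Prop :=
  ∀ i, φ.coeff i ≠ 0 → P (φ.pattern i)

/-- All coefficients are nonnegative integers and all patterns are in `D`. -/
def IsGood (φ : MotifParameter C) (D : ObjectProperty C) : Prop :=
  φ.IsPure D ∧ ∀ i, ∃ n : ℕ, φ.coeff i = n

end MotifParameter

/-! ## Objects as oracles -/

variable (C) in
/-- A way of attaching the objects of `C` as oracles. The objects in `obj j` are encoded as subsets
`code j c` of `{0,1}^(bitsize j)`, where `bitsize` is polynomially bounded in the binary length of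
`j` and computable in polynomial time. Every object is isomorphic to one in some `obj j`. -/
structure OracleEncoding where
  obj : ℕ → Set C
  bitsize : ℕ → ℕ
  bitsize_le : ∃ p : Polynomial ℕ, ∀ j, bitsize j ≤ p.eval (Computability.encodeNat j).length
  bitsize_computable : Nonempty (Turing.TM2ComputableInPolyTime
    Computability.encodeNat Computability.encodeNat bitsize)
  code : ℕ → C → Set (List Bool)
  length_code : ∀ j, ∀ c ∈ obj j, ∀ w ∈ code j c, w.length = bitsize j
  code_injOn : ∀ j, Set.InjOn (code j) (obj j)
  exists_iso : ∀ c : C, ∃ j, ∃ c' ∈ obj j, Nonempty (c ≅ c')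

namespace OracleEncoding

variable (enc : OracleEncoding C)

open Classical in
/-- The oracle that encodes `c ∈ obj j`: the indicator function of its code. -/
def oracle (j : ℕ) (c : C) : Oracle := fun w => decide (w ∈ enc.code j c)

/-- `(x, O)` encodes `c ∈ obj j`: `x` is `j` in binary, and `O` is the oracle of `c`. -/
def Encodes (x : List Bool) (O : Oracle) (j : ℕ) (c : C) : Prop :=
  c ∈ enc.obj j ∧ x = Computability.encodeNat j ∧ O = enc.oracle j c

/-- An input encodes at most one object. -/
theorem Encodes.unique {enc : OracleEncoding C} {x : List Bool} {O : Oracle} {j j' : ℕ} {c c' : C}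
    (h : enc.Encodes x O j c) (h' : enc.Encodes x O j' c') : j = j' ∧ c = c' := by
  obtain ⟨hc, rfl, rfl⟩ := h
  obtain ⟨hc', hj, hO⟩ := h'
  have hjj : j = j' := by
    have := congrArg Computability.decodeNat hj
    simpa using this
  subst hjj
  refine ⟨rfl, enc.code_injOn j hc hc' ?_⟩
  ext w
  have := congrFun hO w
  simpa [oracle] using this

open Classical in
/-- The promise type-2 function `eval φ`: it maps every `(x, O)` that encodes an object `c`
to `φ(c)`, and all other inputs are "don't care" inputs. -/
def eval (φ : C → ℚ) : PromiseFunction where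
  val x O := if h : ∃ (c : C) (j : ℕ), enc.Encodes x O j c then φ h.choose else 0
  dontCare := {xO | ¬ ∃ (c : C) (j : ℕ), enc.Encodes xO.1 xO.2 j c}

theorem eval_val {φ : C → ℚ} {x : List Bool} {O : Oracle} {j : ℕ} {c : C}
    (h : enc.Encodes x O j c) : (enc.eval φ).val x O = φ c := by
  have hex : ∃ (c : C) (j : ℕ), enc.Encodes x O j c := ⟨c, j, h⟩
  have hc : hex.choose = c := (hex.choose_spec.choose_spec.unique h).2
  simp only [eval, dif_pos hex, hc]

end OracleEncoding

/-- A set-instantiator against `(T, c, φ)`, where `T` is a nondeterministic machine. -/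
structure SetInstantiator (enc : OracleEncoding C) (M : MorphismProperty C) (T : OracleTM 1)
    (c : C) (φ : C → ℚ) where
  j : ℕ
  inst : MSub M c → enc.obj j
  /-- the perception function, with `⊤` above all `M`-subobjects under `c` -/
  perc : List Bool → WithTop (MSub M c)
  accepting_iff : ∀ (f : MSub M c) (τ : List Bool),
    T.IsAcceptingPath ![Computability.encodeNat j] (enc.oracle j (inst f)) τ ↔
      perc τ ≤ (f : WithTop (MSub M c))
  val_inst : ∀ f : MSub M c, φ (inst f) = φ f.dom

end

/-! Suppose the evaluation function were in the class. A relation decided by a deterministic machine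
`D` is turned into a nondeterministic polynomial-time machine `T` that guesses the witness `y` and
then runs `D`. Since `D` has at most one accepting path per input, and the choices made while
guessing determine `y`, accepting paths of `T` correspond bijectively to witnesses
(`exists_acc_eq`). So `T` computes `eval φ`, and set-instantiators against `T` are available.

Take one for the object `c = a_i`, a pattern of `φ`. For every `M`-subobject `f` of `c`, the value
`φ(dom f)` is the number of `τ` with `perc τ ≤ f`, hence the sum over `g ≤ f` of the sizes of the
fibres of `perc` (`SetInstantiator.val_dom`). Counting subobjects of `dom f` as subobjects of `c`
below `f` writes the same value as the sum over `g ≤ f` of the coefficient of the pattern isomorphic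
to `dom g`, or zero if there is none (`MotifParameter.val_dom`). On a finite poset, sums over
principal ideals determine their summands (`eq_of_sum_le_eq`). At the largest subobject, the
identity of `a_i`, this says that `α_i` is the size of a fibre, so it is a natural number. Together
with purity, `φ` is good.

The technical work is on the machine side: the length bound `p(|x|)` has to be written in unary on a
tape before guessing (`preloadable`), and both paths and running times have to be tracked through
the construction. -/

/-! ## Machine constructions -/

/-- Transport a command along a map of instructions. -/
def Cmd.map {Q K A Q' K' : Type} (g : Instr Q K A → Instr Q' K' A) : Cmd Q K A → Cmd Q' K' A
  | .halt a => .halt a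
  | .step i => .step (g i)
  | .choose i => .choose fun b => g (i b)
  | .query i => .query fun b => g (i b)

/-- An instruction, executed in the presence of one more tape with `s` under its head. -/
def Instr.lift {Q K A Q' : Type} (f : Q → Q') (s : TapeSym A) (i : Instr Q K A) :
    Instr Q' (Option K) A where
  next := f i.next
  write κ := κ.elim s i.write
  move κ := κ.elim none i.move
  out := i.out

/-- The instruction that performs the given writes and moves and leaves the other cells alone;
`h` are the symbols under the heads. -/
def Instr.act {Q K A : Type} (h : K → TapeSym A) (q : Q)
    (w : K → Option (TapeSym A) × Option Turing.Dir) : Instr Q K A where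
  next := q
  write κ := (w κ).1.getD (h κ)
  move κ := (w κ).2
  out := none

namespace OracleTM

variable {r : ℕ} {T : OracleTM r}

/-! ### Accepting paths, halting times and deterministic runs -/

theorem Cfg.ext_of {c c' : T.Cfg} (hs : c.state = c'.state) (ht : ∀ κ, c.tape κ = c'.tape κ)
    (ho : c.oracleTape = c'.oracleTape) : c = c' := by
  obtain ⟨s, t, o⟩ := c
  obtain ⟨s', t', o'⟩ := c'
  obtain rfl : t = t' := funext ht
  cases hs
  cases ho
  rfl

theorem acceptPath_step {O : Oracle} {c : T.Cfg} {i : Instr T.Q T.K T.A} (h : c.cmd = .step i)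
    (τ : List Bool) : AcceptPath O c τ ↔ AcceptPath O (c.exec i) τ := by
  refine ⟨fun hτ => ?_, fun hτ => .step h hτ⟩
  cases hτ with
  | halt h' => simp [h] at h'
  | step h' hτ => rw [h] at h'; cases h'; exact hτ
  | choose h' b hτ => simp [h] at h'
  | query h' hτ => simp [h] at h'

theorem acceptPath_choose {O : Oracle} {c : T.Cfg} {i : Bool → Instr T.Q T.K T.A}
    (h : c.cmd = .choose i) (τ : List Bool) :
    AcceptPath O c τ ↔ ∃ b τ', τ = b :: τ' ∧ AcceptPath O (c.exec (i b)) τ' := by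
  constructor
  · intro hτ
    cases hτ with
    | halt h' => simp [h] at h'
    | step h' hτ => simp [h] at h'
    | choose h' b hτ => rw [h] at h'; cases h'; exact ⟨b, _, rfl, hτ⟩
    | query h' hτ => simp [h] at h'
  · rintro ⟨b, τ', rfl, hτ⟩
    exact .choose h b hτ

theorem HaltsWithin.succ {O : Oracle} {n : ℕ} {c : T.Cfg} (h : HaltsWithin O n c) :
    HaltsWithin O (n + 1) c := by
  induction n generalizing c with
  | zero => obtain ⟨a, ha⟩ := h; simp [HaltsWithin, ha]
  | succ n ih =>
    unfold HaltsWithin at h ⊢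
    split <;> simp_all

theorem HaltsWithin.mono {O : Oracle} {n m : ℕ} (hnm : n ≤ m) {c : T.Cfg}
    (h : HaltsWithin O n c) : HaltsWithin O m c := by
  induction hnm with
  | refl => exact h
  | step _ ih => exact ih.succ

theorem HaltsWithin.of_step {O : Oracle} {n : ℕ} {c : T.Cfg} {i : Instr T.Q T.K T.A}
    (h : c.cmd = .step i) (hn : HaltsWithin O n (c.exec i)) : HaltsWithin O (n + 1) c := by
  simpa [HaltsWithin, h] using hn

theorem HaltsWithin.of_choose {O : Oracle} {n : ℕ} {c : T.Cfg} {i : Bool → Instr T.Q T.K T.A}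
    (h : c.cmd = .choose i) (hn : ∀ b, HaltsWithin O n (c.exec (i b))) :
    HaltsWithin O (n + 1) c := by
  simpa [HaltsWithin, h] using hn

/-- Each recorded bit costs a step, and plain steps record none. Hence there are only finitely many
accepting paths, so that `ncard` never takes its default value 0 on an infinite set. -/
theorem AcceptPath.length_le {O : Oracle} {c : T.Cfg} {τ : List Bool} (h : AcceptPath O c τ)
    {n : ℕ} (hn : HaltsWithin O n c) : τ.length ≤ n := by
  induction h generalizing n with
  | halt h => simp
  | step h _ ih =>
    cases n with
    | zero => obtain ⟨a, ha⟩ := hn; simp [h] at ha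
    | succ n => simp only [HaltsWithin, h] at hn; exact (ih hn).trans n.le_succ
  | choose h b _ ih =>
    cases n with
    | zero => obtain ⟨a, ha⟩ := hn; simp [h] at ha
    | succ n => simp only [HaltsWithin, h] at hn; simpa using ih (hn b)
  | query h _ ih =>
    cases n with
    | zero => obtain ⟨a, ha⟩ := hn; simp [h] at ha
    | succ n => simp only [HaltsWithin, h] at hn; simpa using ih hn

theorem PolyTime.finite_acceptingPath (hT : T.PolyTime) (x : Fin r → List Bool) (O : Oracle) :
    {τ | T.IsAcceptingPath x O τ}.Finite := by
  obtain ⟨p, hp⟩ := hT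
  exact (List.finite_length_le Bool _).subset fun τ hτ => AcceptPath.length_le hτ (hp x O)

/-- Without choices, all bits of a path are oracle answers, and these are forced by the
configuration. -/
theorem Deterministic.acceptPath_unique (hT : T.Deterministic) {O : Oracle} {c : T.Cfg}
    {τ τ' : List Bool} (h : AcceptPath O c τ) (h' : AcceptPath O c τ') : τ = τ' := by
  induction h generalizing τ' with
  | halt h =>
    cases h' with
    | halt _ => rfl
    | step h' _ => simp [h] at h'
    | choose h' _ _ => simp [h] at h'
    | query h' _ => simp [h] at h'
  | step h _ ih => exact ih ((acceptPath_step h _).1 h')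
  | choose h _ _ _ => exact absurd h (hT _ _ _)
  | query h _ ih =>
    cases h' with
    | halt h' => simp [h] at h'
    | step h' _ => simp [h] at h'
    | choose h' _ _ => simp [h] at h'
    | query h' hτ => rw [h] at h'; cases h'; rw [ih hτ]

/-- `RunsTo n c c'`: the machine gets from `c` to `c'` by `n` deterministic steps that do not use
the oracle. -/
inductive RunsTo : ℕ → T.Cfg → T.Cfg → Prop
  | refl (c : T.Cfg) : RunsTo 0 c c
  | step {c c' : T.Cfg} {n : ℕ} (i : Instr T.Q T.K T.A) (h : c.cmd = .step i)
      (h' : RunsTo n (c.exec i) c') : RunsTo (n + 1) c c'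

theorem RunsTo.trans {n m : ℕ} {c c' c'' : T.Cfg} (h : RunsTo n c c') (h' : RunsTo m c' c'') :
    RunsTo (n + m) c c'' := by
  induction h with
  | refl => simpa using h'
  | step i h _ ih => rw [Nat.add_right_comm]; exact .step i h (ih h')

theorem RunsTo.single {c c' : T.Cfg} (i : Instr T.Q T.K T.A) (h : c.cmd = .step i)
    (h' : c.exec i = c') : RunsTo 1 c c' :=
  .step i h (h' ▸ .refl _)

/-- Plain steps leave no trace in the path, so deterministic preprocessing preserves accepting paths
literally and not just in number. -/
theorem RunsTo.acceptPath_iff {n : ℕ} {c c' : T.Cfg} (h : RunsTo n c c') {O : Oracle}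
    {τ : List Bool} : AcceptPath O c τ ↔ AcceptPath O c' τ := by
  induction h with
  | refl => rfl
  | step i h _ ih => rw [acceptPath_step h, ih]

theorem RunsTo.haltsWithin {n m : ℕ} {c c' : T.Cfg} (h : RunsTo n c c') {O : Oracle}
    (hm : HaltsWithin O m c') : HaltsWithin O (n + m) c := by
  induction h with
  | refl => simpa using hm
  | step i h _ ih => rw [Nat.add_right_comm]; exact .of_step h (ih hm)

theorem exec_act_tape (c : T.Cfg) (q : T.Q)
    (w : T.K → Option (TapeSym T.A) × Option Turing.Dir) (κ : T.K) :
    (c.exec (Instr.act (fun k => (c.tape k).head) q w)).tape κ =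
      moveHead (w κ).2 ((w κ).1.elim (c.tape κ) (c.tape κ).write) := by
  simp only [Cfg.exec, Instr.act]
  cases (w κ).1 <;> simp

/-! ### Running a program before a given machine -/

/-- A machine with one more tape that executes a program of its own, with states `B`, before
it runs `T`. -/
def prelude (T : OracleTM r) {s : ℕ} (B : Type) (hB : Finite B) (inp : Fin s ↪ Option T.K) (b : B)
    (δ : B → (Option T.K → TapeSym T.A) → Cmd (T.Q ⊕ B) (Option T.K) T.A) : OracleTM s where
  K := Option T.K
  A := T.A
  Q := T.Q ⊕ B
  finK := haveI := T.finK; inferInstance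
  finA := T.finA
  finQ := haveI := T.finQ; inferInstance
  inp := inp
  start := .inr b
  δ q h := match q with
    | .inl q => (T.δ q fun κ => h (some κ)).map (Instr.lift .inl (h none))
    | .inr b => δ b h

section Prelude

variable {s : ℕ} {B : Type} {hB : Finite B} {inp : Fin s ↪ Option T.K} {b : B}
  {δ : B → (Option T.K → TapeSym T.A) → Cmd (T.Q ⊕ B) (Option T.K) T.A}

/-- A configuration of `T` as one of the machine with a prelude. -/
def embed (B : Type) (hB : Finite B) (inp : Fin s ↪ Option T.K) (b : B)
    (δ : B → (Option T.K → TapeSym T.A) → Cmd (T.Q ⊕ B) (Option T.K) T.A)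
    (t : Turing.Tape (TapeSym T.A)) (c : T.Cfg) : (T.prelude B hB inp b δ).Cfg where
  state := .inl c.state
  tape κ := Option.elim κ t c.tape
  oracleTape := c.oracleTape

theorem embed_cmd (t : Turing.Tape (TapeSym T.A)) (c : T.Cfg) :
    (embed B hB inp b δ t c).cmd = c.cmd.map (Instr.lift .inl t.head) := rfl

/-- The additional tape rewrites the symbol already under its head and does not move, so its content
`t` is inert while `T` runs. -/
theorem embed_exec (t : Turing.Tape (TapeSym T.A)) (c : T.Cfg) (i : Instr T.Q T.K T.A) :
    (embed B hB inp b δ t c).exec (Instr.lift .inl t.head i) =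
      embed B hB inp b δ t (c.exec i) := by
  refine Cfg.ext_of rfl (fun κ => ?_) rfl
  cases κ with
  | none => exact Turing.Tape.write_self t
  | some κ => rfl

theorem embed_erase_exec (t : Turing.Tape (TapeSym T.A)) (c : T.Cfg) (i : Instr T.Q T.K T.A) :
    (embed B hB inp b δ t c).erase.exec (Instr.lift .inl t.head i) =
      embed B hB inp b δ t (c.erase.exec i) :=
  embed_exec t c.erase i

/-- The simulation is step by step, with the same kind of command each time, so even the recorded
bits coincide. -/
theorem acceptPath_embed {O : Oracle} {t : Turing.Tape (TapeSym T.A)} {c : T.Cfg}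
    {τ : List Bool} : AcceptPath O (embed B hB inp b δ t c) τ ↔ AcceptPath O c τ := by
  constructor
  · generalize hc' : embed B hB inp b δ t c = c'
    intro h
    induction h generalizing c with
    | halt h =>
      subst hc'
      rw [embed_cmd] at h
      cases hc : c.cmd <;> rw [hc] at h <;> simp only [Cmd.map, reduceCtorEq] at h
      cases h
      exact .halt hc
    | step h _ ih =>
      subst hc'
      rw [embed_cmd] at h
      cases hc : c.cmd <;> rw [hc] at h <;> simp only [Cmd.map, reduceCtorEq] at h
      cases h
      exact .step hc (ih (embed_exec _ _ _).symm)
    | choose h b _ ih =>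
      subst hc'
      rw [embed_cmd] at h
      cases hc : c.cmd <;> rw [hc] at h <;> simp only [Cmd.map, reduceCtorEq] at h
      cases h
      exact .choose hc b (ih (embed_exec _ _ _).symm)
    | query h _ ih =>
      subst hc'
      rw [embed_cmd] at h
      cases hc : c.cmd <;> rw [hc] at h <;> simp only [Cmd.map, reduceCtorEq] at h
      cases h
      exact .query hc (ih (embed_erase_exec _ _ _).symm)
  · intro h
    induction h with
    | halt h => exact .halt (by rw [embed_cmd, h]; rfl)
    | step h _ ih =>
      rw [← embed_exec] at ih
      exact .step (by rw [embed_cmd, h]; rfl) ih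
    | @choose c i _ h b _ ih =>
      rw [← embed_exec] at ih
      exact .choose (c := embed B hB inp _ δ t c) (i := fun b => Instr.lift .inl t.head (i b))
        (by rw [embed_cmd, h]; rfl) b ih
    | @query c i _ h _ ih =>
      rw [← embed_erase_exec] at ih
      exact .query (c := embed B hB inp _ δ t c) (i := fun b => Instr.lift .inl t.head (i b))
        (by rw [embed_cmd, h]; rfl) ih

theorem haltsWithin_embed {O : Oracle} {t : Turing.Tape (TapeSym T.A)} {n : ℕ} {c : T.Cfg}
    (h : HaltsWithin O n c) : HaltsWithin O n (embed B hB inp b δ t c) := by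
  induction n generalizing c with
  | zero =>
    obtain ⟨a, ha⟩ := h
    exact ⟨a, by rw [embed_cmd, ha]; rfl⟩
  | succ n ih =>
    unfold HaltsWithin at h ⊢
    rw [embed_cmd]
    cases hc : c.cmd with
    | halt a => trivial
    | step i =>
      rw [hc] at h
      have := ih h
      rwa [← embed_exec] at this
    | choose i =>
      rw [hc] at h
      exact fun b' => (embed_exec (hB := hB) t c (i b')).symm ▸ ih (h b')
    | query i =>
      rw [hc] at h
      have := ih h
      rwa [← embed_erase_exec] at this

end Prelude

end OracleTM

/-! ## Counting the guessed words -/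

noncomputable section

namespace OracleTM

open Turing

/-! ### Tapes as pairs of lists -/

section Tapes

variable {A : Type}

theorem mk₂_move_right (l : List (TapeSym A)) (a : TapeSym A) (r : List (TapeSym A)) :
    (Tape.mk₂ l (a :: r)).move .right = Tape.mk₂ (a :: l) r := by
  simp [Tape.mk₂, Tape.move_right_mk', ListBlank.cons_mk]

theorem mk₂_move_left (l : List (TapeSym A)) (a : TapeSym A) (r : List (TapeSym A)) :
    (Tape.mk₂ (a :: l) r).move .left = Tape.mk₂ l (a :: r) := by
  simp [Tape.mk₂, Tape.move_left_mk', ListBlank.cons_mk]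

theorem mk₂_nil_move_left (r : List (TapeSym A)) :
    (Tape.mk₂ [] r).move .left = Tape.mk₂ [] (none :: r) := by
  simp only [Tape.mk₂, Tape.move_left_mk', ListBlank.head_mk, ListBlank.tail_mk, ListBlank.cons_mk]
  rfl

theorem mk₂_write (l : List (TapeSym A)) (a b : TapeSym A) (r : List (TapeSym A)) :
    (Tape.mk₂ l (a :: r)).write b = Tape.mk₂ l (b :: r) := by
  simp [Tape.mk₂, ← ListBlank.cons_mk]

/-- Trailing blanks are invisible; this lets a head step off the written part of a tape and return
without changing the tape. -/
theorem listBlank_mk_none : ListBlank.mk [(none : TapeSym A)] = ListBlank.mk [] :=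
  ListBlank.cons_head_tail (ListBlank.mk ([] : List (TapeSym A)))

theorem mk₂_none_left (r : List (TapeSym A)) : Tape.mk₂ [none] r = Tape.mk₂ [] r := by
  simp [Tape.mk₂, listBlank_mk_none]

theorem mk₂_none_right (l : List (TapeSym A)) : Tape.mk₂ l [none] = Tape.mk₂ l [] := by
  simp [Tape.mk₂, listBlank_mk_none]

theorem mk₂_head_cons (l : List (TapeSym A)) (a : TapeSym A) (r : List (TapeSym A)) :
    (Tape.mk₂ l (a :: r)).head = a := by
  simp [Tape.mk₂]

theorem mk₂_head_nil (l : List (TapeSym A)) : (Tape.mk₂ l []).head = none := by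
  rw [← mk₂_none_right, mk₂_head_cons]

/-- The tape that holds a word, with the head on its first bit. -/
def bitTape (A : Type) (x : List Bool) : Tape (TapeSym A) :=
  Tape.mk₂ [] (x.map fun b => some (.inl b))

/-- `n` marks. -/
def marks (A : Type) (n : ℕ) : List (TapeSym A) := List.replicate n (some (.inl true))

theorem marks_succ (n : ℕ) : marks A (n + 1) = some (.inl true) :: marks A n :=
  List.replicate_succ

/-- What a head does: it may write a symbol and then move. -/
abbrev HeadAct (A : Type) : Type := Option (TapeSym A) × Option Dir

/-- The effect of a head action on the tape. -/
def HeadAct.app (a : HeadAct A) (t : Tape (TapeSym A)) : Tape (TapeSym A) :=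
  moveHead a.2 (a.1.elim t t.write)

end Tapes

/-! ### Programs that touch only three tapes -/

/-- An instruction for three tapes. -/
structure TriInstr (Q A : Type) where
  next : Q
  fst : HeadAct A
  snd : HeadAct A
  thd : HeadAct A

section Tri

variable {K A : Type}

open Classical in
/-- A function that is given on the tapes `i` and `k` and on the additional tape, and constant
otherwise. -/
def tri {α : Type} (i k : K) (a b c d : α) (κ : Option K) : α :=
  κ.elim c fun κ => if κ = i then a else if κ = k then b else d

/-- The instruction for all tapes that is given by one for three tapes. -/
def TriInstr.toInstr {Q : Type} (i k : K) (h : Option K → TapeSym A) (ι : TriInstr Q A) :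
    Instr Q (Option K) A :=
  .act h ι.next (tri i k ι.fst ι.snd ι.thd (none, none))

/-- The program that uses only the tapes `i` and `k` and the additional tape. -/
def triProgram {Q B : Type} (i k : K)
    (δ : B → TapeSym A → TapeSym A → TapeSym A →
      TriInstr (Q ⊕ B) A ⊕ (Bool → TriInstr (Q ⊕ B) A))
    (b : B) (h : Option K → TapeSym A) : Cmd (Q ⊕ B) (Option K) A :=
  match δ b (h (some i)) (h (some k)) (h none) with
  | .inl ι => .step (ι.toInstr i k h)
  | .inr ι => .choose fun c => (ι c).toInstr i k h

end Tri

section TriPrelude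

variable {r s : ℕ} {T : OracleTM r} {B : Type} {hB : Finite B} {inp : Fin s ↪ Option T.K} {b₀ : B}
  {i k : T.K}
  {δ : B → TapeSym T.A → TapeSym T.A → TapeSym T.A →
    TriInstr (T.Q ⊕ B) T.A ⊕ (Bool → TriInstr (T.Q ⊕ B) T.A)}

/-- The configuration with given contents of three tapes, where all the other tapes are empty. -/
def triCfg (T : OracleTM r) {B : Type} (hB : Finite B) (inp : Fin s ↪ Option T.K) (b₀ : B)
    (i k : T.K)
    (δ : B → TapeSym T.A → TapeSym T.A → TapeSym T.A →
      TriInstr (T.Q ⊕ B) T.A ⊕ (Bool → TriInstr (T.Q ⊕ B) T.A))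
    (q : T.Q ⊕ B) (t₁ t₂ t₃ : Tape (TapeSym T.A)) :
    (T.prelude B hB inp b₀ (triProgram i k δ)).Cfg where
  state := q
  tape := tri i k t₁ t₂ t₃ (Tape.mk₁ [])
  oracleTape := []

theorem triCfg_exec (hik : k ≠ i) (q : T.Q ⊕ B) (t₁ t₂ t₃ : Tape (TapeSym T.A))
    (ι : TriInstr (T.Q ⊕ B) T.A) :
    (triCfg T hB inp b₀ i k δ q t₁ t₂ t₃).exec
        (ι.toInstr i k fun κ => (tri i k t₁ t₂ t₃ (Tape.mk₁ []) κ).head) =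
      triCfg T hB inp b₀ i k δ ι.next (ι.fst.app t₁) (ι.snd.app t₂) (ι.thd.app t₃) := by
  refine Cfg.ext_of rfl (fun κ => ?_) rfl
  refine (exec_act_tape _ _ _ κ).trans ?_
  change moveHead (tri i k ι.fst ι.snd ι.thd (none, none) κ).2
    ((tri i k ι.fst ι.snd ι.thd (none, none) κ).1.elim (tri i k t₁ t₂ t₃ (Tape.mk₁ []) κ)
      (tri i k t₁ t₂ t₃ (Tape.mk₁ []) κ).write) =
    tri i k (ι.fst.app t₁) (ι.snd.app t₂) (ι.thd.app t₃) (Tape.mk₁ []) κ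
  rcases κ with _ | κ
  · rfl
  · by_cases hi : κ = i
    · simp [tri, hi, HeadAct.app]
    · by_cases hk : κ = k
      · simp [tri, hk, hik, HeadAct.app]
      · simp [tri, hk, hi, moveHead]

theorem triCfg_cmd (hik : k ≠ i) (b : B) (t₁ t₂ t₃ : Tape (TapeSym T.A)) :
    (triCfg T hB inp b₀ i k δ (.inr b) t₁ t₂ t₃).cmd =
      match δ b t₁.head t₂.head t₃.head with
      | .inl ι => .step (ι.toInstr i k fun κ => (tri i k t₁ t₂ t₃ (Tape.mk₁ []) κ).head)
      | .inr ι =>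
        .choose fun c => (ι c).toInstr i k fun κ => (tri i k t₁ t₂ t₃ (Tape.mk₁ []) κ).head := by
  have h₁ : tri i k t₁ t₂ t₃ (Tape.mk₁ []) (some i) = t₁ := by simp [tri]
  have h₂ : tri i k t₁ t₂ t₃ (Tape.mk₁ []) (some k) = t₂ := by simp [tri, hik]
  have h₃ : tri i k t₁ t₂ t₃ (Tape.mk₁ []) none = t₃ := rfl
  change triProgram i k δ b (fun κ => (tri i k t₁ t₂ t₃ (Tape.mk₁ []) κ).head) = _
  unfold triProgram
  simp only [h₁, h₂, h₃]
  cases δ b t₁.head t₂.head t₃.head <;> rfl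

/-- Reduces a step of a concrete program to evaluating `δ` on three symbols, which is usually `rfl`
once the heads are known. -/
theorem runsTo_triCfg (hik : k ≠ i) {b : B} {t₁ t₂ t₃ : Tape (TapeSym T.A)}
    {ι : TriInstr (T.Q ⊕ B) T.A} (h : δ b t₁.head t₂.head t₃.head = .inl ι) :
    RunsTo 1 (triCfg T hB inp b₀ i k δ (.inr b) t₁ t₂ t₃)
      (triCfg T hB inp b₀ i k δ ι.next (ι.fst.app t₁) (ι.snd.app t₂) (ι.thd.app t₃)) :=
  .single _ (by rw [triCfg_cmd hik, h]) (triCfg_exec hik ..)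

theorem acceptPath_triCfg (hik : k ≠ i) {b : B} {t₁ t₂ t₃ : Tape (TapeSym T.A)}
    {ι : Bool → TriInstr (T.Q ⊕ B) T.A} (h : δ b t₁.head t₂.head t₃.head = .inr ι) {O : Oracle}
    {τ : List Bool} :
    AcceptPath O (triCfg T hB inp b₀ i k δ (.inr b) t₁ t₂ t₃) τ ↔ ∃ c τ', τ = c :: τ' ∧
      AcceptPath O (triCfg T hB inp b₀ i k δ (ι c).next ((ι c).fst.app t₁) ((ι c).snd.app t₂)
        ((ι c).thd.app t₃)) τ' := by
  have hc := triCfg_cmd (T := T) (hB := hB) (inp := inp) (b₀ := b₀) (δ := δ) hik b t₁ t₂ t₃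
  rw [h] at hc
  rw [acceptPath_choose hc]
  simp only [triCfg_exec hik]

theorem haltsWithin_triCfg (hik : k ≠ i) {b : B} {t₁ t₂ t₃ : Tape (TapeSym T.A)}
    {ι : Bool → TriInstr (T.Q ⊕ B) T.A} (h : δ b t₁.head t₂.head t₃.head = .inr ι) {O : Oracle}
    {n : ℕ} (hn : ∀ c, HaltsWithin O n
      (triCfg T hB inp b₀ i k δ (ι c).next ((ι c).fst.app t₁) ((ι c).snd.app t₂)
        ((ι c).thd.app t₃))) :
    HaltsWithin O (n + 1) (triCfg T hB inp b₀ i k δ (.inr b) t₁ t₂ t₃) := by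
  have hc := triCfg_cmd (T := T) (hB := hB) (inp := inp) (b₀ := b₀) (δ := δ) hik b t₁ t₂ t₃
  rw [h] at hc
  refine .of_choose hc fun c => ?_
  rw [triCfg_exec hik]
  exact hn c

end TriPrelude

/-- Moving the head of a tape back to the beginning of its contents. -/
theorem runsTo_rewind {r : ℕ} {T : OracleTM r} {A : Type} {c c' : Tape (TapeSym A) → T.Cfg}
    (h : ∀ t, t.head ≠ none → RunsTo 1 (c t) (c (t.move .left)))
    (h' : ∀ t, t.head = none → RunsTo 1 (c t) (c' (t.move .right))) (l r : List (TapeSym A))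
    (hl : ∀ a ∈ l, a ≠ none) :
    RunsTo (l.length + 1) (c ((Tape.mk₂ l r).move .left)) (c' (Tape.mk₂ [] (l.reverse ++ r))) := by
  induction l generalizing r with
  | nil =>
    -- The head has reached the blank left of the contents: one step to the right ends the
    -- rewinding, and the blank that is left behind is absorbed.
    have := h' _ (mk₂_head_cons [] none r)
    rw [mk₂_move_right, mk₂_none_left] at this
    rw [mk₂_nil_move_left]
    exact this
  | cons a l ih =>
    have := (h (Tape.mk₂ l (a :: r)) (by rw [mk₂_head_cons]; exact hl a (by simp))).trans
      (ih (a :: r) fun b hb => hl b (by simp [hb]))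
    rw [mk₂_move_left, List.length_cons, Nat.add_comm _ 1]
    simpa using this

open Classical in
/-- The initial configuration on input `x`, except that the tape `k` holds the number `m` in
unary. -/
def loaded (T : OracleTM 1) (k : T.K) (m : ℕ) (x : List Bool) : T.Cfg where
  state := T.start
  tape κ := if κ = T.inp 0 then bitTape T.A x else
    if κ = k then Tape.mk₂ [] (marks T.A m) else Tape.mk₁ []
  oracleTape := []

theorem init_eq_loaded (T : OracleTM 1) (k : T.K) (x : Fin 1 → List Bool) :
    T.init x = T.loaded k 0 (x 0) := by
  refine Cfg.ext_of rfl (fun κ => ?_) rfl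
  simp only [init, loaded]
  split_ifs with h h'
  · rw [h, T.inp.injective.extend_apply]
    rfl
  · rw [Function.extend_apply']
    · rfl
    · rintro ⟨a, rfl⟩
      exact h (by rw [Subsingleton.elim a 0])
  · rw [Function.extend_apply']
    rintro ⟨a, rfl⟩
    exact h (by rw [Subsingleton.elim a 0])

theorem ite_eq_tri_none {K α : Type} {i : K} (k : K) {j : Option K} (hj : j = some i) (a c d : α)
    (κ : Option K) :
    @ite _ (κ = j) (Classical.propDecidable _) a
      (@ite _ (κ = none) (Classical.propDecidable _) c d) = tri i k a d c d κ := by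
  subst hj
  rcases κ with _ | κ
  · simp [tri]
  · by_cases h : κ = i <;> simp [tri, h]

theorem ite_eq_tri_some {K α : Type} {i : K} (k : K) {j : Option K} (hj : j = some i) (a b d : α)
    (κ : Option K) :
    @ite _ (κ = j) (Classical.propDecidable _) a
      (@ite _ (κ = some k) (Classical.propDecidable _) b d) = tri i k a b d d κ := by
  subst hj
  rcases κ with _ | κ
  · simp [tri]
  · by_cases h : κ = i
    · simp [tri, h]
    · by_cases h' : κ = k
      · subst h'
        simp [tri, h]
      · simp [tri, h, h']

section Loaded

variable {r : ℕ} {T : OracleTM r} {B : Type} {hB : Finite B} {inp : Fin 1 ↪ Option T.K} {b₀ : B}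
  {i k : T.K}
  {δ : B → TapeSym T.A → TapeSym T.A → TapeSym T.A →
    TriInstr (T.Q ⊕ B) T.A ⊕ (Bool → TriInstr (T.Q ⊕ B) T.A)}

theorem loaded_none (hinp : inp 0 = some i) (m : ℕ) (x : List Bool) :
    (T.prelude B hB inp b₀ (triProgram i k δ)).loaded (none : Option T.K) m x =
      triCfg T hB inp b₀ i k δ (.inr b₀) (bitTape T.A x) (Tape.mk₂ [] [])
        (Tape.mk₂ [] (marks T.A m)) :=
  Cfg.ext_of rfl (ite_eq_tri_none k hinp _ _ _) rfl

theorem loaded_some (hinp : inp 0 = some i) (m : ℕ) (x : List Bool) :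
    (T.prelude B hB inp b₀ (triProgram i k δ)).loaded (some k : Option T.K) m x =
      triCfg T hB inp b₀ i k δ (.inr b₀) (bitTape T.A x) (Tape.mk₂ [] (marks T.A m))
        (Tape.mk₂ [] []) :=
  Cfg.ext_of rfl (ite_eq_tri_some k hinp _ _ _) rfl

end Loaded

/-! ### Computing a polynomial in unary -/

/-- The polynomial `p` can be computed in unary before another machine is run. -/
def Preloadable (p : Polynomial ℕ) : Prop :=
  ∀ (T : OracleTM 1) (k : T.K), k ≠ T.inp 0 → ∃ (T' : OracleTM 1) (q : Polynomial ℕ),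
    ∀ (x : Fin 1 → List Bool) (O : Oracle),
      (∀ τ, AcceptPath O (T'.init x) τ ↔
        AcceptPath O (T.loaded k (p.eval (x 0).length) (x 0)) τ) ∧
      ∀ n, HaltsWithin O n (T.loaded k (p.eval (x 0).length) (x 0)) →
        HaltsWithin O (q.eval (x 0).length + n) (T'.init x)

/-- To load `p'` for `T`, put a prelude before `T` that converts `p(n)` marks into `p'(n)` marks,
and load `p` for the resulting machine. This is why `Preloadable` quantifies over all machines and
tapes. The prelude may leave garbage `t` on its own tape. -/
theorem Preloadable.of_runsTo {p p' : Polynomial ℕ} (hp : Preloadable p)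
    (H : ∀ (T : OracleTM 1) (k : T.K), k ≠ T.inp 0 →
      ∃ (B : Type) (hB : Finite B) (inp : Fin 1 ↪ Option T.K) (b : B)
        (δ : B → (Option T.K → TapeSym T.A) → Cmd (T.Q ⊕ B) (Option T.K) T.A)
        (k' : Option T.K) (q : Polynomial ℕ), k' ≠ inp 0 ∧ ∀ x : List Bool, ∃ t,
          RunsTo (q.eval x.length) ((T.prelude B hB inp b δ).loaded k' (p.eval x.length) x)
            (embed B hB inp b δ t (T.loaded k (p'.eval x.length) x))) :
    Preloadable p' := by
  intro T k hk
  obtain ⟨B, hB, inp, b, δ, k', q, hk', hrun⟩ := H T k hk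
  obtain ⟨T', q', hT'⟩ := hp (T.prelude B hB inp b δ) k' hk'
  refine ⟨T', q' + q, fun x O => ⟨fun τ => ?_, fun n hn => ?_⟩⟩
  · obtain ⟨t, ht⟩ := hrun (x 0)
    rw [(hT' x O).1, ht.acceptPath_iff, acceptPath_embed]
  · obtain ⟨t, ht⟩ := hrun (x 0)
    have := (hT' x O).2 _ (ht.haltsWithin (haltsWithin_embed hn))
    rwa [Polynomial.eval_add, add_assoc]

theorem preloadable_zero : Preloadable 0 := fun T k _ =>
  ⟨T, 0, fun x O => by simp [init_eq_loaded T k x]⟩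

/-- The program that increments the number on the second tape. -/
def succProgram {Q A : Type} (q : Q) :
    Bool → TapeSym A → TapeSym A → TapeSym A →
      TriInstr (Q ⊕ Bool) A ⊕ (Bool → TriInstr (Q ⊕ Bool) A)
  | false, _, _, _ => .inl ⟨.inr true, (none, none), (none, some .left), (none, none)⟩
  | true, _, _, _ => .inl ⟨.inl q, (none, none), (some (some (.inl true)), none), (none, none)⟩

/-- The new mark goes into the cell left of the existing ones, so two steps suffice, and the head
ends on the first mark with no rewinding. -/
theorem Preloadable.add_one {p : Polynomial ℕ} (hp : Preloadable p) : Preloadable (p + 1) := by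
  refine hp.of_runsTo fun T k hk => ⟨Bool, inferInstance, T.inp.trans .some, false,
    triProgram (T.inp 0) k (succProgram T.start), some k, 2, by simpa using hk,
    fun x => ⟨Tape.mk₂ [] [], ?_⟩⟩
  rw [loaded_some (by rfl)]
  have h₁ := runsTo_triCfg (T := T) (hB := inferInstance) (inp := T.inp.trans .some) (b₀ := false)
    (δ := succProgram T.start) (b := false) (t₁ := bitTape T.A x)
    (t₂ := Tape.mk₂ [] (marks T.A (p.eval x.length))) (t₃ := Tape.mk₂ [] []) hk rfl
  have h₂ := h₁.trans (runsTo_triCfg hk rfl)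
  rw [show (2 : Polynomial ℕ).eval x.length = 1 + 1 by simp]
  convert h₂ using 1
  simp only [HeadAct.app, moveHead, Option.elim, mk₂_nil_move_left, mk₂_write]
  rw [Polynomial.eval_add, Polynomial.eval_one]
  rfl

/-- The program that multiplies the number on the third tape with the length of the word on the
first tape. -/
def mulProgram {Q A : Type} (q : Q) :
    Fin 3 → TapeSym A → TapeSym A → TapeSym A →
      TriInstr (Q ⊕ Fin 3) A ⊕ (Bool → TriInstr (Q ⊕ Fin 3) A)
  | 0, _, _, none => .inl ⟨.inl q, (none, none), (none, some .right), (none, none)⟩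
  | 0, _, _, some _ => .inl ⟨.inr 1, (none, none), (none, none), (none, some .right)⟩
  | 1, none, _, _ => .inl ⟨.inr 2, (none, some .left), (none, none), (none, none)⟩
  | 1, some _, _, _ => .inl ⟨.inr 1, (none, some .right),
      (some (some (.inl true)), some .left), (none, none)⟩
  | 2, none, _, _ => .inl ⟨.inr 0, (none, some .right), (none, none), (none, none)⟩
  | 2, some _, _, _ => .inl ⟨.inr 2, (none, some .left), (none, none), (none, none)⟩

section Mul

variable {T : OracleTM 1} {k : T.K}

/-- The configurations of the multiplication program. -/
abbrev mulCfg (T : OracleTM 1) (k : T.K) (q : T.Q ⊕ Fin 3) (t₁ t₂ t₃ : Tape (TapeSym T.A)) :=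
  triCfg T inferInstance (T.inp.trans .some) 0 (T.inp 0) k (mulProgram T.start) q t₁ t₂ t₃

theorem runsTo_mulCfg (hk : k ≠ T.inp 0) {b : Fin 3} {t₁ t₂ t₃ : Tape (TapeSym T.A)}
    {ι : TriInstr (T.Q ⊕ Fin 3) T.A} (h : mulProgram T.start b t₁.head t₂.head t₃.head = .inl ι) :
    RunsTo 1 (mulCfg T k (.inr b) t₁ t₂ t₃)
      (mulCfg T k ι.next (ι.fst.app t₁) (ι.snd.app t₂) (ι.thd.app t₃)) :=
  runsTo_triCfg hk h

/-- The invariant is that the head of the second tape stands on the blank just left of the marks;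
each bit of `x` turns that blank into a mark and moves the head to the next blank. -/
theorem runsTo_mul_sweep (hk : k ≠ T.inp 0) (l : List (TapeSym T.A)) (x : List Bool) (n : ℕ)
    (t : Tape (TapeSym T.A)) :
    RunsTo x.length
      (mulCfg T k (.inr 1) (Tape.mk₂ l (x.map fun b => some (.inl b)))
        (Tape.mk₂ [] (none :: marks T.A n)) t)
      (mulCfg T k (.inr 1) (Tape.mk₂ ((x.map fun b => some (.inl b)).reverse ++ l) [])
        (Tape.mk₂ [] (none :: marks T.A (n + x.length))) t) := by
  induction x generalizing l n with
  | nil => exact .refl _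
  | cons b x ih =>
    have h₁ := runsTo_mulCfg hk (b := 1)
      (t₁ := Tape.mk₂ l ((b :: x).map fun b => some (.inl b)))
      (t₂ := Tape.mk₂ [] (none :: marks T.A n)) (t₃ := t)
      (by rw [List.map_cons, mk₂_head_cons]; rfl)
    simp only [HeadAct.app, moveHead, Option.elim, mk₂_nil_move_left, mk₂_write, List.map_cons,
      mk₂_move_right] at h₁
    have h₂ := h₁.trans (ih (some (.inl b) :: l) (n + 1))
    rw [List.length_cons, Nat.add_comm _ 1, ← add_assoc]
    simpa using h₂

/-- `x.length` steps for the sweep, one to turn around at the blank, and `x.length + 1` to rewind.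
-/
theorem runsTo_mul_round (hk : k ≠ T.inp 0) (x : List Bool) (n : ℕ) (t : Tape (TapeSym T.A)) :
    RunsTo (2 * x.length + 2)
      (mulCfg T k (.inr 1) (bitTape T.A x) (Tape.mk₂ [] (none :: marks T.A n)) t)
      (mulCfg T k (.inr 0) (bitTape T.A x) (Tape.mk₂ [] (none :: marks T.A (n + x.length))) t) := by
  have h₁ := runsTo_mul_sweep hk [] x n t
  have h₂ := runsTo_mulCfg hk (b := 1)
    (t₁ := Tape.mk₂ ((x.map fun b => some (.inl b)).reverse ++ []) [])
    (t₂ := Tape.mk₂ [] (none :: marks T.A (n + x.length))) (t₃ := t)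
    (by rw [mk₂_head_nil]; rfl)
  have h₃ := runsTo_rewind
    (c := fun t₁ => mulCfg T k (.inr 2) t₁ (Tape.mk₂ [] (none :: marks T.A (n + x.length))) t)
    (c' := fun t₁ => mulCfg T k (.inr 0) t₁ (Tape.mk₂ [] (none :: marks T.A (n + x.length))) t)
    (fun t₁ ht => by
      obtain ⟨a, ha⟩ := Option.ne_none_iff_exists'.1 ht
      exact runsTo_mulCfg hk (b := 2) (t₁ := t₁)
        (t₂ := Tape.mk₂ [] (none :: marks T.A (n + x.length))) (t₃ := t) (by rw [ha]; rfl))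
    (fun t₁ ht => runsTo_mulCfg hk (b := 2) (t₁ := t₁)
        (t₂ := Tape.mk₂ [] (none :: marks T.A (n + x.length))) (t₃ := t) (by rw [ht]; rfl))
    ((x.map fun b => some (.inl b)).reverse ++ []) [] (by
      simp only [List.append_nil, List.mem_reverse, List.mem_map]
      rintro _ ⟨b, _, rfl⟩
      simp)
  have := (h₁.trans h₂).trans h₃
  rw [show 2 * x.length + 2 = x.length + 1 + (((x.map fun b =>
    (some (.inl b) : TapeSym T.A)).reverse ++ []).length + 1) by simp; ring]
  simpa [bitTape] using this

/-- Every mark on the third tape triggers one round and one step to pass over the mark; `l` collects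
the marks passed. The last step moves the second head from the blank onto the marks. -/
theorem runsTo_mul (hk : k ≠ T.inp 0) (x : List Bool) (n m : ℕ) (l : List (TapeSym T.A)) :
    ∃ t, RunsTo (m * (2 * x.length + 3) + 1)
      (mulCfg T k (.inr 0) (bitTape T.A x) (Tape.mk₂ [] (none :: marks T.A n))
        (Tape.mk₂ l (marks T.A m)))
      (mulCfg T k (.inl T.start) (bitTape T.A x) (Tape.mk₂ [] (marks T.A (n + m * x.length))) t) := by
  induction m generalizing n l with
  | zero =>
    have h₁ := runsTo_mulCfg hk (b := 0) (t₁ := bitTape T.A x)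
      (t₂ := Tape.mk₂ [] (none :: marks T.A n)) (t₃ := Tape.mk₂ l [])
      (by rw [mk₂_head_nil]; rfl)
    simp only [HeadAct.app, moveHead, Option.elim, mk₂_move_right, mk₂_none_left] at h₁
    exact ⟨_, by simpa [marks] using h₁⟩
  | succ m ih =>
    have h₁ := runsTo_mulCfg hk (b := 0) (t₁ := bitTape T.A x)
      (t₂ := Tape.mk₂ [] (none :: marks T.A n)) (t₃ := Tape.mk₂ l (marks T.A (m + 1)))
      (by rw [marks_succ, mk₂_head_cons]; rfl)
    simp only [HeadAct.app, moveHead, Option.elim, marks_succ, mk₂_move_right] at h₁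
    obtain ⟨t, ht⟩ := ih (n + x.length) (some (.inl true) :: l)
    refine ⟨t, ?_⟩
    have := (h₁.trans (runsTo_mul_round hk x n _)).trans ht
    rw [show (m + 1) * (2 * x.length + 3) + 1 =
      1 + (2 * x.length + 2) + (m * (2 * x.length + 3) + 1) by ring,
      show n + (m + 1) * x.length = n + x.length + m * x.length by ring]
    exact this

end Mul

theorem Preloadable.mul_X {p : Polynomial ℕ} (hp : Preloadable p) :
    Preloadable (p * Polynomial.X) := by
  -- The multiplier `p(n)` is loaded on the additional tape `none`, while the product is built on
  -- the tape `k`, which is empty at the start.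
  refine hp.of_runsTo fun T k hk => ⟨Fin 3, inferInstance, T.inp.trans .some, 0,
    triProgram (T.inp 0) k (mulProgram T.start), none, p * (2 * Polynomial.X + 3) + 1, by simp,
    fun x => ?_⟩
  obtain ⟨t, ht⟩ := runsTo_mul hk x 0 (p.eval x.length) []
  refine ⟨t, ?_⟩
  rw [loaded_none (by rfl)]
  simp only [show marks T.A 0 = [] from rfl, mk₂_none_right, zero_add] at ht
  convert ht using 1
  · simp
  · simp only [Polynomial.eval_mul, Polynomial.eval_X]
    rfl

theorem Preloadable.add_natCast {p : Polynomial ℕ} (hp : Preloadable p) (a : ℕ) :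
    Preloadable (p + (a : Polynomial ℕ)) := by
  induction a with
  | zero => simpa using hp
  | succ a ih => simpa [add_assoc] using ih.add_one

/-- Horner's scheme: zero, adding one and multiplying by the input length generate all polynomials
over `ℕ`. -/
theorem preloadable (p : Polynomial ℕ) : Preloadable p := by
  induction p using Polynomial.recOnHorner with
  | M0 => exact preloadable_zero
  | MC p a _ _ hp => simpa using hp.add_natCast a
  | MX p _ hp => exact hp.mul_X

end OracleTM

end
-- Guessing a word of bounded length
noncomputable section

namespace OracleTM

open Turing

/-- The program that guesses a word on the second tape which is at most as long as the number on
the third tape. -/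
def guessProgram {Q A : Type} (q : Q) :
    Fin 3 → TapeSym A → TapeSym A → TapeSym A →
      TriInstr (Q ⊕ Fin 3) A ⊕ (Bool → TriInstr (Q ⊕ Fin 3) A)
  | 0, _, _, none => .inl ⟨.inr 2, (none, none), (none, some .left), (none, none)⟩
  | 0, _, _, some _ => .inr fun c => if c then ⟨.inr 1, (none, none), (none, none), (none, none)⟩
      else ⟨.inr 2, (none, none), (none, some .left), (none, none)⟩
  | 1, _, _, _ => .inr fun b =>
      ⟨.inr 0, (none, none), (some (some (.inl b)), some .right), (none, some .right)⟩
  | 2, _, none, _ => .inl ⟨.inl q, (none, none), (none, some .right), (none, none)⟩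
  | 2, _, some _, _ => .inl ⟨.inr 2, (none, none), (none, some .left), (none, none)⟩

/-- The choices that are made when `y` is guessed, where `m` bounds the length of `y`. -/
def guessPath : ℕ → List Bool → List Bool
  -- When the bound is used up, the program stops without a choice, so no stop bit is recorded.
  | 0, _ => []
  | _ + 1, [] => [false]
  | m + 1, b :: y => true :: b :: guessPath m y

/-- The guesses form a prefix code: each letter is announced by `true`, and an early end by `false`.
So `y` can be read off whatever follows. -/
theorem guessPath_append_inj {m : ℕ} {y y' : List Bool} (hy : y.length ≤ m) (hy' : y'.length ≤ m)
    {τ τ' : List Bool} (h : guessPath m y ++ τ = guessPath m y' ++ τ') : y = y' := by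
  induction m generalizing y y' with
  | zero => rw [List.eq_nil_of_length_eq_zero (Nat.le_zero.1 hy),
      List.eq_nil_of_length_eq_zero (Nat.le_zero.1 hy')]
  | succ m ih =>
    rcases y with _ | ⟨b, y⟩ <;> rcases y' with _ | ⟨b', y'⟩
    · rfl
    · simp [guessPath] at h
    · simp [guessPath] at h
    · simp only [guessPath, List.cons_append, List.cons.injEq, true_and] at h
      rw [h.1, ih (by simpa using hy) (by simpa using hy') h.2]

section Guess

variable {D : OracleTM 2}

/-- The input tape of the guessing machine is the first input tape of `D`. -/
def guessInp (D : OracleTM 2) : Fin 1 ↪ Option D.K :=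
  ⟨fun _ => some (D.inp 0), fun _ _ _ => Subsingleton.elim _ _⟩

/-- The machine that guesses the second input of `D` and runs `D`. Its additional tape has to be
loaded with the length bound. -/
def guess (D : OracleTM 2) : OracleTM 1 :=
  D.prelude (Fin 3) inferInstance (guessInp D) 0
    (triProgram (D.inp 0) (D.inp 1) (guessProgram D.start))

/-- The configurations of the guessing program. -/
abbrev guessCfg (D : OracleTM 2) (q : D.Q ⊕ Fin 3) (t₁ t₂ t₃ : Tape (TapeSym D.A)) :=
  triCfg D inferInstance (guessInp D) 0 (D.inp 0) (D.inp 1) (guessProgram D.start) q t₁ t₂ t₃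

theorem inp_one_ne (D : OracleTM 2) : D.inp 1 ≠ D.inp 0 := fun h => by
  simpa using D.inp.injective h

theorem runsTo_guessCfg {b : Fin 3} {t₁ t₂ t₃ : Tape (TapeSym D.A)}
    {ι : TriInstr (D.Q ⊕ Fin 3) D.A}
    (h : guessProgram D.start b t₁.head t₂.head t₃.head = .inl ι) :
    RunsTo 1 (guessCfg D (.inr b) t₁ t₂ t₃)
      (guessCfg D ι.next (ι.fst.app t₁) (ι.snd.app t₂) (ι.thd.app t₃)) :=
  runsTo_triCfg (inp_one_ne D) h

theorem tri_eq_extend {K α : Type} (e : Fin 2 ↪ K) (f : Fin 2 → α) (c d : α) (κ : K) :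
    tri (e 0) (e 1) (f 0) (f 1) c d (some κ) = Function.extend e f (fun _ => d) κ := by
  by_cases h₀ : κ = e 0
  · rw [h₀, e.injective.extend_apply]
    simp [tri]
  · by_cases h₁ : κ = e 1
    · rw [h₁, e.injective.extend_apply]
      simp [tri]
    · rw [Function.extend_apply']
      · simp [tri, h₀, h₁]
      · rintro ⟨a, rfl⟩
        fin_cases a
        · exact h₀ rfl
        · exact h₁ rfl

/-- After guessing, the tapes of `D` are exactly as in its initial configuration, and only the inert
tape remembers the length bound. -/
theorem guessCfg_final (x y : List Bool) (t : Tape (TapeSym D.A)) :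
    guessCfg D (.inl D.start) (bitTape D.A x) (bitTape D.A y) t =
      embed (Fin 3) inferInstance (guessInp D) 0
        (triProgram (D.inp 0) (D.inp 1) (guessProgram D.start)) t (D.init ![x, y]) := by
  refine Cfg.ext_of rfl (fun κ => ?_) rfl
  rcases κ with _ | κ
  · rfl
  · exact tri_eq_extend D.inp (fun i => bitTape D.A (![x, y] i)) t _ κ

theorem runsTo_guess_rewind (x w : List Bool) (t : Tape (TapeSym D.A)) :
    RunsTo (w.length + 1)
      (guessCfg D (.inr 2) (bitTape D.A x)
        ((Tape.mk₂ (w.map fun b => some (.inl b)).reverse []).move .left) t)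
      (guessCfg D (.inl D.start) (bitTape D.A x) (bitTape D.A w) t) := by
  have := runsTo_rewind
    (c := fun t₂ => guessCfg D (.inr 2) (bitTape D.A x) t₂ t)
    (c' := fun t₂ => guessCfg D (.inl D.start) (bitTape D.A x) t₂ t)
    (fun t₂ ht => by
      obtain ⟨a, ha⟩ := Option.ne_none_iff_exists'.1 ht
      exact runsTo_guessCfg (b := 2) (t₁ := bitTape D.A x) (t₂ := t₂) (t₃ := t) (by rw [ha]; rfl))
    (fun t₂ ht => runsTo_guessCfg (b := 2) (t₁ := bitTape D.A x) (t₂ := t₂) (t₃ := t)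
      (by rw [ht]; rfl))
    (w.map fun b => some (.inl b)).reverse [] (by
      simp only [List.mem_reverse, List.mem_map]
      rintro _ ⟨b, _, rfl⟩
      simp)
  simpa [bitTape] using this

theorem guess_write (w : List Bool) (b : Bool) :
    HeadAct.app (some (some (.inl b)), some .right)
        (Tape.mk₂ (w.map fun b => (some (.inl b) : TapeSym D.A)).reverse []) =
      Tape.mk₂ ((w ++ [b]).map fun b => some (.inl b)).reverse [] := by
  rw [← mk₂_none_right]
  simp only [HeadAct.app, moveHead, Option.elim, mk₂_write, mk₂_move_right]
  simp

theorem marks_move_right (l : List (TapeSym D.A)) (m : ℕ) :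
    HeadAct.app (none, some .right) (Tape.mk₂ l (marks D.A (m + 1))) =
      Tape.mk₂ (some (.inl true) :: l) (marks D.A m) := by
  simp only [HeadAct.app, moveHead, Option.elim, marks_succ, mk₂_move_right]

theorem acceptPath_rewind {O : Oracle} (x w : List Bool) (t : Tape (TapeSym D.A))
    {τ : List Bool} :
    AcceptPath O (guessCfg D (.inr 2) (bitTape D.A x)
        ((Tape.mk₂ (w.map fun b => some (.inl b)).reverse []).move .left) t) τ ↔
      AcceptPath O (D.init ![x, w]) τ := by
  rw [(runsTo_guess_rewind x w t).acceptPath_iff, guessCfg_final, acceptPath_embed]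

/-- The induction is on the remaining bound `m`, with the part `w` guessed so far stored in reverse
to the left of the head. -/
theorem acceptPath_guess {O : Oracle} (x w : List Bool) (m : ℕ) (l : List (TapeSym D.A))
    {τ : List Bool} :
    AcceptPath O (guessCfg D (.inr 0) (bitTape D.A x)
        (Tape.mk₂ (w.map fun b => some (.inl b)).reverse []) (Tape.mk₂ l (marks D.A m))) τ ↔
      ∃ y : List Bool, y.length ≤ m ∧ ∃ τ', τ = guessPath m y ++ τ' ∧
        AcceptPath O (D.init ![x, w ++ y]) τ' := by
  induction m generalizing w l τ with
  | zero =>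
    have h₁ := runsTo_guessCfg (D := D) (b := 0) (t₁ := bitTape D.A x)
      (t₂ := Tape.mk₂ (w.map fun b => some (.inl b)).reverse [])
      (t₃ := Tape.mk₂ l []) (by rw [mk₂_head_nil]; rfl)
    refine h₁.acceptPath_iff.trans ((acceptPath_rewind x w _).trans ?_)
    simp [guessPath]
  | succ m ih =>
    refine (acceptPath_triCfg (inp_one_ne D)
      (by rw [marks_succ, mk₂_head_cons]; rfl)).trans ?_
    constructor
    · rintro ⟨c, τ, rfl, h⟩
      rcases c with _ | _
      · exact ⟨[], by simp, τ, rfl, by simpa using (acceptPath_rewind x w _).1 h⟩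
      · have h : AcceptPath O (guessCfg D (.inr 1) (bitTape D.A x)
          (Tape.mk₂ (w.map fun b => (some (.inl b) : TapeSym D.A)).reverse [])
          (Tape.mk₂ l (marks D.A (m + 1)))) τ := h
        obtain ⟨b, τ, rfl, h'⟩ := (acceptPath_triCfg (inp_one_ne D) (by rfl)).1 h
        have h : AcceptPath O (guessCfg D (.inr 0) (bitTape D.A x)
          (HeadAct.app (some (some (.inl b)), some .right)
            (Tape.mk₂ (w.map fun b => (some (.inl b) : TapeSym D.A)).reverse []))
          (HeadAct.app (none, some .right) (Tape.mk₂ l (marks D.A (m + 1))))) τ := h'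
        rw [guess_write, marks_move_right, ih] at h
        obtain ⟨y, hy, τ, rfl, h''⟩ := h
        exact ⟨b :: y, by simpa using hy, τ, rfl, by simpa using h''⟩
    · rintro ⟨y, hy, τ, rfl, h⟩
      rcases y with _ | ⟨b, y⟩
      · exact ⟨false, τ, rfl, (acceptPath_rewind x w _).2 (by simpa using h)⟩
      · refine ⟨true, b :: (guessPath m y ++ τ), rfl, ?_⟩
        change AcceptPath O (guessCfg D (.inr 1) (bitTape D.A x)
          (Tape.mk₂ (w.map fun b => (some (.inl b) : TapeSym D.A)).reverse [])
          (Tape.mk₂ l (marks D.A (m + 1)))) _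
        refine (acceptPath_triCfg (inp_one_ne D) (by rfl)).2 ⟨b, _, rfl, ?_⟩
        change AcceptPath O (guessCfg D (.inr 0) (bitTape D.A x)
          (HeadAct.app (some (some (.inl b)), some .right)
            (Tape.mk₂ (w.map fun b => (some (.inl b) : TapeSym D.A)).reverse []))
          (HeadAct.app (none, some .right) (Tape.mk₂ l (marks D.A (m + 1))))) _
        rw [guess_write, marks_move_right, ih]
        exact ⟨y, by simpa using hy, τ, rfl, by simpa using h⟩

theorem haltsWithin_rewind {O : Oracle} (x w : List Bool) (t : Tape (TapeSym D.A)) {n : ℕ}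
    (h : HaltsWithin O n (D.init ![x, w])) :
    HaltsWithin O (w.length + 1 + n) (guessCfg D (.inr 2) (bitTape D.A x)
        ((Tape.mk₂ (w.map fun b => some (.inl b)).reverse []).move .left) t) := by
  refine (runsTo_guess_rewind x w t).haltsWithin ?_
  rw [guessCfg_final]
  exact haltsWithin_embed h

/-- A further letter costs three steps, two for the choices and one for rewinding over it; the
letters of `w` still have to be rewound, and stopping and the final move to the right cost the
remaining two. -/
theorem haltsWithin_guess {O : Oracle} (x w : List Bool) (m : ℕ) (l : List (TapeSym D.A)) {n : ℕ}
    (h : ∀ y : List Bool, y.length ≤ m → HaltsWithin O n (D.init ![x, w ++ y])) :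
    HaltsWithin O (w.length + 3 * m + 2 + n) (guessCfg D (.inr 0) (bitTape D.A x)
        (Tape.mk₂ (w.map fun b => some (.inl b)).reverse []) (Tape.mk₂ l (marks D.A m))) := by
  induction m generalizing w l with
  | zero =>
    have h₁ := runsTo_guessCfg (D := D) (b := 0) (t₁ := bitTape D.A x)
      (t₂ := Tape.mk₂ (w.map fun b => some (.inl b)).reverse [])
      (t₃ := Tape.mk₂ l []) (by rw [mk₂_head_nil]; rfl)
    have h₂ := h₁.haltsWithin (haltsWithin_rewind x w _ (by simpa using h [] (by simp)))
    exact h₂.mono (by omega)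
  | succ m ih =>
    rw [show w.length + 3 * (m + 1) + 2 + n = (w.length + 1 + 3 * m + 2 + n) + 1 + 1 by ring]
    refine haltsWithin_triCfg (inp_one_ne D) (by rw [marks_succ, mk₂_head_cons]; rfl) fun c => ?_
    rcases c with _ | _
    · exact (haltsWithin_rewind x w _ (by simpa using h [] (by simp))).mono (by omega)
    · change HaltsWithin O _ (guessCfg D (.inr 1) (bitTape D.A x)
        (Tape.mk₂ (w.map fun b => (some (.inl b) : TapeSym D.A)).reverse [])
        (Tape.mk₂ l (marks D.A (m + 1))))
      refine haltsWithin_triCfg (inp_one_ne D) (by rfl) fun b => ?_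
      change HaltsWithin O _ (guessCfg D (.inr 0) (bitTape D.A x)
          (HeadAct.app (some (some (.inl b)), some .right)
            (Tape.mk₂ (w.map fun b => (some (.inl b) : TapeSym D.A)).reverse []))
          (HeadAct.app (none, some .right) (Tape.mk₂ l (marks D.A (m + 1)))))
      rw [guess_write, marks_move_right]
      refine (ih (w ++ [b]) _ fun y hy => ?_).mono (by simp)
      simpa using h (b :: y) (by simpa using hy)

theorem guess_loaded (m : ℕ) (x : List Bool) :
    (guess D).loaded (none : Option D.K) m x =
      guessCfg D (.inr 0) (bitTape D.A x) 
        (Tape.mk₂ (([] : List Bool).map fun b => some (.inl b)).reverse [])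
        (Tape.mk₂ [] (marks D.A m)) :=
  loaded_none rfl m x

end Guess

theorem _root_.Polynomial.eval_mono_nat (p : Polynomial ℕ) {a b : ℕ} (h : a ≤ b) :
    p.eval a ≤ p.eval b := by
  rw [Polynomial.eval_eq_sum_range, Polynomial.eval_eq_sum_range]
  gcongr

/-- The number of short second inputs that a deterministic machine accepts is the number of
accepting paths of a nondeterministic machine. -/
theorem exists_acc_eq {D : OracleTM 2} (hdet : D.Deterministic) (hD : D.PolyTime)
    (p : Polynomial ℕ) : ∃ T : OracleTM 1, T.PolyTime ∧ ∀ (x : List Bool) (O : Oracle),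
      T.acc ![x] O = {y : List Bool | y.length ≤ p.eval x.length ∧ D.Accepts ![x, y] O}.ncard := by
  obtain ⟨T, q, hT⟩ := preloadable p (guess D) (none : Option D.K) (by simp [guess, prelude, guessInp])
  obtain ⟨d, hd⟩ := hD
  -- Loading the bound takes `q` steps and guessing at most `3 * p + 2`; then `D` runs on inputs of
  -- total length at most `|x| + p(|x|)`.
  refine ⟨T, ⟨q + (3 * p + 2 + d.comp (Polynomial.X + p)), fun x O => ?_⟩, fun x O => ?_⟩
  · have := (hT x O).2 (3 * p.eval (x 0).length + 2 +
      d.eval ((x 0).length + p.eval (x 0).length)) (by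
        rw [guess_loaded]
        have := haltsWithin_guess (D := D) (O := O) (x 0) [] (p.eval (x 0).length) []
          (n := d.eval ((x 0).length + p.eval (x 0).length)) fun y hy =>
            (hd ![x 0, y] O).mono (d.eval_mono_nat (by simpa using hy))
        exact HaltsWithin.mono (T := guess D) (by simp) this)
    simpa [Polynomial.eval_comp] using this
  · have hacc (y : List Bool) (hy : y ∈ {y : List Bool | y.length ≤ p.eval x.length ∧
        D.Accepts ![x, y] O}) : ∃ τ, AcceptPath O (D.init ![x, y]) τ := hy.2
    symm
    -- A witness `y` corresponds to its guess followed by the accepting path of `D`; surjectivity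
    -- needs that `D`, being deterministic, has only one such path.
    refine Set.ncard_congr (fun y hy => guessPath (p.eval x.length) y ++ (hacc y hy).choose)
      ?_ ?_ ?_
    · intro y hy
      refine ((hT ![x] O).1 _).2 ?_
      rw [guess_loaded]
      exact (acceptPath_guess ..).2 ⟨y, hy.1, _, rfl, (hacc y hy).choose_spec⟩
    · intro y y' hy hy' h
      exact guessPath_append_inj hy.1 hy'.1 h
    · intro τ hτ
      have hτ := ((hT ![x] O).1 _).1 hτ
      rw [guess_loaded] at hτ
      obtain ⟨y, hy, τ', rfl, h⟩ := (acceptPath_guess ..).1 hτ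
      have hy : y ∈ {y : List Bool | y.length ≤ p.eval x.length ∧ D.Accepts ![x, y] O} :=
        ⟨hy, τ', h⟩
      exact ⟨y, hy, congrArg _ (hdet.acceptPath_unique (hacc y hy).choose_spec h)⟩

end OracleTM

/-- A function in `Pr-#P` is computed by a nondeterministic polynomial-time machine. -/
theorem PrSharpP.exists_computes {F : PromiseFunction} (hF : PrSharpP F) :
    ∃ T : OracleTM 1, T.PolyTime ∧ T.Computes F := by
  obtain ⟨R, ⟨D, hdet, hD, hR⟩, p, hp⟩ := hF
  obtain ⟨T, hT, hacc⟩ := OracleTM.exists_acc_eq hdet hD p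
  refine ⟨T, hT, fun x O h => ?_⟩
  rw [hacc, ← hp x O h]
  simp only [hR, TypeTwoRel.count]

end

/-! ## Counting `M`-subobjects -/

section Subobjects

variable {C : Type u} [Category.{v} C] {E M : MorphismProperty C}

/-- If `g = p ∘ i` is the factorization of `g`, then `f ∘ g` factors both as the identity followed
by `f ∘ g` and as `i` followed by `f ∘ p`. By uniqueness `i` is an isomorphism, so `g` is in `M`. -/
theorem IsProperFactorizationSystem.right_of_comp (h : IsProperFactorizationSystem E M) {a b c : C}
    {g : a ⟶ b} {f : b ⟶ c} (hf : M f) (hgf : M (g ≫ f)) : M g := by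
  have := h.comp_right
  obtain ⟨d⟩ := h.exists_fac g
  let d₁ : MorphismProperty.MapFactorizationData E M (g ≫ f) :=
    { Z := a, i := 𝟙 a, p := g ≫ f, fac := by simp,
      hi := h.iso_left _ (.infer_property _), hp := hgf }
  let d₂ : MorphismProperty.MapFactorizationData E M (g ≫ f) :=
    { Z := d.Z, i := d.i, p := d.p ≫ f, fac := by rw [← Category.assoc, d.fac],
      hi := d.hi, hp := M.comp_mem _ _ d.hp hf }
  obtain ⟨e, ⟨he, _⟩, _⟩ := h.unique_fac _ d₁ d₂
  have : Mono f := h.mono _ hf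
  obtain ⟨e', ⟨he', _⟩, _⟩ := h.unique_fac _ d₂ d₁
  have hi : d.i = e'.hom := by simpa [d₁, d₂] using he'.symm
  rw [← d.fac, hi]
  exact M.comp_mem _ _ (h.iso_right _ (.infer_property _)) d.hp

theorem IsProperFactorizationSystem.mk_arrow (h : IsProperFactorizationSystem E M) {a b : C}
    {i : a ⟶ b} [Mono i] (hi : M i) : M (Subobject.mk i).arrow := by
  have := h.comp_right
  rw [← Subobject.underlyingIso_hom_comp_eq_mk]
  exact M.comp_mem _ _ (h.iso_right _ (.infer_property _)) hi

/-- The `M`-subobjects of `a` under the domain of `f` are those under `c` that are below `f`. -/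
theorem IsProperFactorizationSystem.cntMSub_dom (h : IsProperFactorizationSystem E M) (a : C)
    {c : C} (f : MSub M c) :
    cntMSub M a f.dom = {g : MSub M c | g ≤ f ∧ Nonempty (g.dom ≅ a)}.ncard := by
  have := h.comp_right
  -- Composition with the arrow of `f` is the bijection; `f` being mono makes it injective.
  refine Set.ncard_congr
    (fun S _ => ⟨Subobject.mk (S.1.arrow ≫ f.1.arrow),
      h.mk_arrow (M.comp_mem _ _ S.2 f.2)⟩) ?_ ?_ ?_
  · rintro S ⟨e⟩
    exact ⟨Subobject.mk_le_of_comm S.1.arrow rfl, ⟨Subobject.underlyingIso _ ≪≫ e⟩⟩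
  · intro S S' _ _ hSS
    have hSS := congrArg Subtype.val hSS
    refine Subtype.ext (le_antisymm ?_ ?_)
    · refine Subobject.le_of_comm (Subobject.ofMkLEMk _ _ hSS.le) ?_
      rw [← cancel_mono f.1.arrow]
      simp
    · refine Subobject.le_of_comm (Subobject.ofMkLEMk _ _ hSS.ge) ?_
      rw [← cancel_mono f.1.arrow]
      simp
  · rintro g ⟨hg, ⟨e⟩⟩
    -- Surjectivity: the map through which `g` factors has to be in `M` itself.
    have hM : M (Subobject.ofLE g.1 f.1 hg) :=
      h.right_of_comp f.2 (by rw [Subobject.ofLE_arrow]; exact g.2)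
    refine ⟨⟨Subobject.mk (Subobject.ofLE g.1 f.1 hg), h.mk_arrow hM⟩,
      ⟨Subobject.underlyingIso _ ≪≫ e⟩, Subtype.ext ?_⟩
    refine le_antisymm (Subobject.mk_le_of_comm (Subobject.underlyingIso _).hom ?_)
      (Subobject.le_mk_of_comm (Subobject.underlyingIso _).inv (by simp))
    rw [← Subobject.ofLE_arrow hg, ← Category.assoc, Subobject.underlyingIso_hom_comp_eq_mk]

/-- A function on a finite poset is determined by its sums over principal ideals. -/
theorem eq_of_sum_le_eq {α : Type*} [PartialOrder α] [Fintype α] [DecidableLE α] {u w : α → ℚ}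
    (h : ∀ f, ∑ g with g ≤ f, u g = ∑ g with g ≤ f, w g) : u = w := by
  classical
  funext f
  induction f using WellFoundedLT.induction with
  | ind f ih =>
    -- Möbius inversion without the Möbius function: the terms strictly below `f` agree by induction
    -- and cancel.
    have hs : Finset.univ.filter (· ≤ f) = insert f (Finset.univ.filter (· < f)) := by
      ext g; simp [le_iff_eq_or_lt]
    have hf := h f
    rw [hs, Finset.sum_insert (by simp), Finset.sum_insert (by simp),
      Finset.sum_congr rfl fun g hg => ih g (by simpa using hg)] at hf
    exact add_right_cancel hf

open Classical in
/-- The value of a motif parameter on the domain of `f`, as a sum over the `M`-subobjects below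
`f`. -/
theorem MotifParameter.val_dom (h : IsProperFactorizationSystem E M) (φ : MotifParameter C) {c : C}
    [Fintype (MSub M c)] (f : MSub M c) :
    φ.val M f.dom =
      ∑ g with g ≤ f, ∑ i, if Nonempty (g.dom ≅ φ.pattern i) then φ.coeff i else 0 := by
  rw [Finset.sum_comm]
  refine Finset.sum_congr rfl fun i _ => ?_
  rw [h.cntMSub_dom, ← Finset.sum_filter, Finset.sum_const, nsmul_eq_mul, mul_comm,
    Finset.filter_filter, Set.ncard_eq_toFinset_card', Set.toFinset_ofPred]

open Classical in
/-- A set-instantiator turns the number of accepting paths into a sum over the `M`-subobjects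
below `f`. -/
theorem SetInstantiator.val_dom {enc : OracleEncoding C} {T : OracleTM 1} {c : C} {φ : C → ℚ}
    (hT : T.PolyTime) (hTφ : T.Computes (enc.eval φ)) (S : SetInstantiator enc M T c φ)
    [Fintype (MSub M c)] (f : MSub M c) :
    φ f.dom = ∑ g with g ≤ f, ({τ | S.perc τ = (g : WithTop (MSub M c))}.ncard : ℚ) := by
  -- The running time bounds the accepting paths, so the cardinalities below are those of finite
  -- sets.
  have hfin (f : MSub M c) : {τ | S.perc τ ≤ (f : WithTop (MSub M c))}.Finite := by
    simpa only [S.accepting_iff] using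
      OracleTM.PolyTime.finite_acceptingPath hT ![Computability.encodeNat S.j] (enc.oracle S.j (S.inst f))
  have henc : enc.Encodes (Computability.encodeNat S.j) (enc.oracle S.j (S.inst f)) S.j
      (S.inst f) := ⟨(S.inst f).2, rfl, rfl⟩
  have hval := hTφ _ _ (by
    simp only [OracleEncoding.eval, Set.mem_ofPred_eq, not_not]
    exact ⟨_, _, henc⟩)
  rw [enc.eval_val henc, S.val_inst] at hval
  rw [← hval, OracleTM.acc]
  simp only [S.accepting_iff]
  rw [← Nat.cast_sum, Nat.cast_inj, Set.ncard_eq_toFinset_card _ (hfin f)]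
  have hfib (g : MSub M c) : {τ | S.perc τ = (g : WithTop (MSub M c))}.Finite :=
    (hfin g).subset fun τ hτ => le_of_eq hτ
  -- The accepting paths are sorted by the subobject they perceive; those strings with value `⊤` are
  -- never accepting.
  rw [Finset.card_eq_sum_card_fiberwise (f := S.perc)
    (t := (Finset.univ.filter (· ≤ f)).map ⟨_, WithTop.coe_injective⟩), Finset.sum_map]
  · refine Finset.sum_congr rfl fun g hg => ?_
    rw [Set.ncard_eq_toFinset_card _ (hfib g)]
    congr 1
    ext τ
    simp only [Function.Embedding.coeFn_mk, Finset.mem_filter, Set.Finite.mem_toFinset,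
      Set.mem_ofPred_eq, and_iff_right_iff_imp]
    intro hτ
    rw [hτ]
    exact WithTop.coe_le_coe.2 (by simpa using hg)
  · intro τ hτ
    have hτ : S.perc τ ≤ f := by simpa using hτ
    obtain ⟨g, hg⟩ := WithTop.ne_top_iff_exists.1 (ne_top_of_le_ne_top WithTop.coe_ne_top hτ)
    rw [← hg] at hτ
    simpa [← hg] using hτ

/-- If a polynomial-time machine computes a motif parameter and there are set-instantiators, then
all coefficients are natural numbers. -/
theorem MotifParameter.coeff_natCast (h : IsProperFactorizationSystem E M)
    (hwp : FinitelyWellPowered M) {enc : OracleEncoding C} (φ : MotifParameter C) {T : OracleTM 1}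
    (hT : T.PolyTime) (hTφ : T.Computes (enc.eval (φ.val M)))
    (hSI : ∀ c : C, Nonempty (SetInstantiator enc M T c (φ.val M))) (i : Fin φ.s) :
    ∃ n : ℕ, φ.coeff i = n := by
  classical
  -- The pattern itself serves as the object `c`, so that its coefficient shows up at its largest
  -- subobject.
  obtain ⟨S⟩ := hSI (φ.pattern i)
  have := hwp (φ.pattern i)
  have := Fintype.ofFinite (MSub M (φ.pattern i))
  have heq := eq_of_sum_le_eq fun f => (φ.val_dom h f).symm.trans (S.val_dom hT hTφ f)
  let t : MSub M (φ.pattern i) := ⟨⊤, h.iso_right _ (.infer_property _)⟩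
  have e : t.dom ≅ φ.pattern i := asIso (⊤ : Subobject (φ.pattern i)).arrow
  -- The natural number is the size of the fibre of `perc` over `t`. On the other side only the
  -- summand of `i` survives, because the patterns are pairwise non-isomorphic.
  refine ⟨_, Eq.trans ?_ (congrFun heq t)⟩
  rw [Finset.sum_eq_single i]
  · rw [if_pos ⟨e⟩]
  · rintro i' _ hi'
    rw [if_neg]
    rintro ⟨e'⟩
    exact hi' (φ.noniso _ _ ⟨e'.symm ≪≫ e⟩)
  · simp

end Subobjects

theorem mainTheorem3 {C : Type u} [Category.{v} C] (P : ObjectProperty C)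
    (hP : P.IsClosedUnderIsomorphisms) (E M : MorphismProperty C)
    (hfacC : IsProperFactorizationSystem E M)
    (hfacP : IsProperFactorizationSystem (E.inverseImage P.ι) (M.inverseImage P.ι))
    (hwpC : FinitelyWellPowered M) (hwpP : FinitelyWellPowered (M.inverseImage P.ι))
    (hjeC : JointEmbedding M) (hjeP : JointEmbedding (M.inverseImage P.ι))
    (hRamsey : IsRamsey M) (hBlowup : Blowup P M)
    (enc : OracleEncoding C) (φ : MotifParameter C) (hφ : φ.IsPure P)
    (hSI : ∀ T : OracleTM 1, T.PolyTime → T.Computes (enc.eval (φ.val M)) →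
      ∀ c : C, Nonempty (SetInstantiator enc M T c (φ.val M)))
    (hgood : ¬ φ.IsGood P) :
    ¬ PrSharpP (enc.eval (φ.val M)) := by
  intro h
  obtain ⟨T, hT, hTφ⟩ := h.exists_computes
  exact hgood ⟨hφ, φ.coeff_natCast hfacC hwpC hT hTφ (hSI T hT hTφ)⟩
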